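/- Fix $N\ge 0$. Let $\mathfrak{LC}$ be the set of Lipschitz Carathéodory functions $f:\mathbb R\times\mathbb R^N\to\mathbb R^N$, i.e. Borel measurable functions such that for every compact $K\subset\mathbb R^N$ there are $m^K,l^K\in L^1_{loc}(\mathbb R)$ with, for almost every $t$, $|f(t,x)|\le m^K(t)$ and $|f(t,x)-f(t,y)|\le l^K(t)|x-y|$ for all $x,y\in K$; functions of this kind that are equal almost everywhere in $\mathbb R^{1+N}$ are identified. Let $f_t(s,x)=f(s+t,x)$. Let $\mathcal T$ be a metrizable topology on $\mathfrak{LC}$, with a fixed metric inducing it, let $f\in\mathfrak{LC}$ and let $\mathrm{Hull}(f)$ be the closure of $\{f_t\mid t\in\mathbb R\}$ in $(\mathfrak{LC},\mathcal T)$. For $g\in\mathfrak{LC}$ let $x(\cdot,g,x_0)$ be the Carathéodory solution of $\dot x=g(t,x)$, $x(0)=x_0$. Assume that the skew-product semiflow induced by $f$ is defined and continuous, that is: $g_t\in \mathrm{Hull}(f)$ for all $g\in\mathrm{Hull}(f)$ and $t\in\mathbb R$; for all $g\in \mathrm{Hull}(f)$ and $x_0\in\mathbb R^N$ the solution $x(\cdot,g,x_0)$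 is defined on $[0,\infty)$; and the map $\Pi(t,g,x_0)=(g_t,x(t,g,x_0))$ is continuous on $[0,\infty)\times\mathrm{Hull}(f)\times\mathbb R^N$. Write $x(t,g,D)=\{x(t,g,x_0)\mid x_0\in D\}$. Assume that there is a bounded set $B\subset\mathbb R^N$ such that for each nonempty bounded set $D\subset\mathbb R^N$ there is $T(D)\ge 0$ with $x(t,f_s,D)\subset B$ for all $t\ge T(D)$ and all $s\in\mathbb R$. Let $\mathrm{dist}(A,C)=\sup_{x\in A}\inf_{y\in C}d(x,y)$ be the Hausdorff semi-distance. A family $\{A_g\mid g\in\mathrm{Hull}(f)\}$ of nonempty compact subsets of $\mathbb R^N$ is a bounded pullback attractor if $x(t,g,A_g)=A_{g_t}$ for all $t\ge0$ and $g\in\mathrm{Hull}(f)$, $\lim_{t\to\infty}\mathrm{dist}(x(t,g_{-t},D),A_g)=0$ for every nonempty bounded $D\subset\mathbb R^N$ and every $g\in\mathrm{Hull}(f)$, and $\bigcup_{g}A_g$ is bounded. A nonempty compact set $\mathcal A\subset\mathrm{Hull}(f)\times\mathbb R^N$ is a global attractor if $\Pi(t,\mathcal A)=\mathcal A$ for all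 $t\ge0$, $\lim_{t\to\infty}\mathrm{dist}(\Pi(t,\mathcal D),\mathcal A)=0$ for every nonempty compact $\mathcal D\subset\mathrm{Hull}(f)\times\mathbb R^N$, and $\mathcal A$ contains every compact $\mathcal C\subset\mathrm{Hull}(f)\times\mathbb R^N$ with $\Pi(t,\mathcal C)=\mathcal C$ for all $t\ge0$. Then: (i) there is a unique bounded pullback attractor, and it is given by $$A_g=\bigcap_{\tau\ge0}\overline{\bigcup_{t\ge\tau}x(t,g_{-t},B)},\qquad g\in\mathrm{Hull}(f);$$ (ii) if $\mathrm{Hull}(f)$ is compact, there is a global attractor, given by $$\mathcal A=\bigcap_{\tau\ge0}\overline{\bigcup_{t\ge\tau}\Pi(t,\mathrm{Hull}(f)\times B)}=\bigcup_{g\in\mathrm{Hull}(f)}\{g\}\times A_g .$$ -/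

import Mathlib

open MeasureTheory Set Filter Topology Bornology
open scoped ENNReal

/-- The phase space `ℝ^N` with its Euclidean norm. -/
abbrev Phase (N : ℕ) : Type := EuclideanSpace ℝ (Fin N)

/-- `F : ℝ × ℝ^N → ℝ^N` is Lipschitz Carathéodory: Borel measurable, with locally integrable
bounds (`m`-bounds) and locally integrable Lipschitz constants (`l`-bounds) on compact sets. -/
structure IsLipschitzCaratheodory {N : ℕ} (F : ℝ × Phase N → Phase N) : Prop where
  measurable : Measurable F
  mbound : ∀ K : Set (Phase N), IsCompact K →
    ∃ m : ℝ → ℝ, LocallyIntegrable m volume ∧ ∀ᵐ t : ℝ, ∀ x ∈ K, ‖F (t, x)‖ ≤ m t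
  lbound : ∀ K : Set (Phase N), IsCompact K →
    ∃ l : ℝ → ℝ, LocallyIntegrable l volume ∧
      ∀ᵐ t : ℝ, ∀ x ∈ K, ∀ y ∈ K, ‖F (t, x) - F (t, y)‖ ≤ l t * ‖x - y‖

/-- Lipschitz Carathéodory functions, before the almost everywhere identification. -/
def LCFun (N : ℕ) : Type :=
  {F : ℝ × Phase N → Phase N // IsLipschitzCaratheodory F}

/-- Two Lipschitz Carathéodory functions are identified when they differ only on a negligible
subset of `ℝ^{1+N}`. -/
def LCFun.setoid (N : ℕ) : Setoid (LCFun N) where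
  r F G := F.1 =ᵐ[(volume : Measure (ℝ × Phase N))] G.1
  iseqv := ⟨fun _ => EventuallyEq.rfl, fun h => h.symm, fun h h' => h.trans h'⟩

/-- The space `LC` of Lipschitz Carathéodory functions, modulo almost everywhere equality. It
carries no topology by default: the topology is a parameter of the results. -/
def LC (N : ℕ) : Type := Quotient (LCFun.setoid N)

/-- A Lipschitz Carathéodory representative of an element of `LC`. Two such representatives `F`,
`G` satisfy `F (t, ·) = G (t, ·)` for almost every `t`, so the choice does not affect solutions. -/
noncomputable def LC.rep {N : ℕ} (g : LC N) : ℝ × Phase N → Phase N :=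
  (Quotient.out g).1

theorem measurePreserving_timeShift (N : ℕ) (t : ℝ) :
    MeasurePreserving (fun p : ℝ × Phase N => (p.1 + t, p.2)) volume volume :=
  (measurePreserving_add_right (volume : Measure ℝ) t).prod
    (MeasurePreserving.id (volume : Measure (Phase N)))

theorem locallyIntegrable_timeShift {m : ℝ → ℝ} (hm : LocallyIntegrable m volume) (t : ℝ) :
    LocallyIntegrable (fun s => m (s + t)) volume := by
  rw [locallyIntegrable_iff] at hm ⊢
  intro K hK
  have h := hm ((fun s => s + t) '' K) (hK.image (continuous_add_const t))
  exact ((measurePreserving_add_right (volume : Measure ℝ) t).integrableOn_image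
    (measurableEmbedding_addRight t)).1 h

theorem IsLipschitzCaratheodory.timeShift {N : ℕ} {F : ℝ × Phase N → Phase N}
    (hF : IsLipschitzCaratheodory F) (t : ℝ) :
    IsLipschitzCaratheodory (fun p : ℝ × Phase N => F (p.1 + t, p.2)) where
  measurable := hF.measurable.comp (measurePreserving_timeShift N t).measurable
  mbound K hK := by
    obtain ⟨m, hm, h⟩ := hF.mbound K hK
    exact ⟨fun s => m (s + t), locallyIntegrable_timeShift hm t,
      (measurePreserving_add_right (volume : Measure ℝ) t).quasiMeasurePreserving.ae h⟩
  lbound K hK := by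
    obtain ⟨l, hl, h⟩ := hF.lbound K hK
    exact ⟨fun s => l (s + t), locallyIntegrable_timeShift hl t,
      (measurePreserving_add_right (volume : Measure ℝ) t).quasiMeasurePreserving.ae h⟩

/-- Time translation `g ↦ g_t`, where `g_t (s, x) = g (s + t, x)`. -/
def LC.translate {N : ℕ} (t : ℝ) : LC N → LC N :=
  Quotient.map' (s₁ := LCFun.setoid N) (s₂ := LCFun.setoid N)
    (fun F : LCFun N => (⟨fun p => F.1 (p.1 + t, p.2), F.2.timeShift t⟩ : LCFun N))
    (fun _ _ h => (measurePreserving_timeShift N t).quasiMeasurePreserving.ae_eq_comp h)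

/-- The hull of `f`: the closure in `LC` of the set of its time translates. -/
def LC.hull {N : ℕ} [TopologicalSpace (LC N)] (f : LC N) : Set (LC N) :=
  closure (range fun t : ℝ => LC.translate t f)

/-- `x` is a (Carathéodory) solution on `[0, ∞)` of `x' = g(t, x)`, `x(0) = x₀`. -/
def LC.IsSolution {N : ℕ} (g : LC N) (x₀ : Phase N) (x : ℝ → Phase N) : Prop :=
  ContinuousOn x (Ici 0) ∧
    ∀ t : ℝ, 0 ≤ t →
      IntervalIntegrable (fun s => g.rep (s, x s)) volume 0 t ∧
        x t = x₀ + ∫ s in (0 : ℝ)..t, g.rep (s, x s)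

/-- `LC.sol t g x₀` is the value `x(t, g, x₀)`, `t ≥ 0`, of the solution of `x' = g(t, x)`,
`x(0) = x₀` (meaningful when this solution is defined on `[0, ∞)`). -/
noncomputable def LC.sol {N : ℕ} (t : ℝ) (g : LC N) (x₀ : Phase N) : Phase N :=
  Classical.epsilon (fun x : ℝ → Phase N => g.IsSolution x₀ x) t

/-- The skew-product map `Π(t, g, x₀) = (g_t, x(t, g, x₀))`. -/
noncomputable def LC.skewProduct {N : ℕ} (t : ℝ) (p : LC N × Phase N) : LC N × Phase N :=
  (LC.translate t p.1, LC.sol t p.1 p.2)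

/-- The Hausdorff semi-distance `sup_{x ∈ A} inf_{y ∈ B} d(x, y)`. -/
noncomputable def hausdorffSemidist {X : Type*} [PseudoEMetricSpace X] (A B : Set X) : ℝ≥0∞ :=
  ⨆ x ∈ A, ⨅ y ∈ B, edist x y

/-- The family `A g`, `g ∈ hull f`, is a pullback attractor for the skew-product semiflow over
`hull f` (the values of `A` outside `hull f` are irrelevant). -/
structure IsPullbackAttractor {N : ℕ} [TopologicalSpace (LC N)] (f : LC N)
    (A : LC N → Set (Phase N)) : Prop where
  nonempty : ∀ g ∈ f.hull, (A g).Nonempty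
  isCompact : ∀ g ∈ f.hull, IsCompact (A g)
  invariant : ∀ t : ℝ, 0 ≤ t → ∀ g ∈ f.hull, LC.sol t g '' A g = A (LC.translate t g)
  attracts : ∀ D : Set (Phase N), D.Nonempty → IsBounded D → ∀ g ∈ f.hull,
    Tendsto (fun t : ℝ => hausdorffSemidist (LC.sol t (LC.translate (-t) g) '' D) (A g))
      atTop (𝓝 0)

/-- A bounded pullback attractor: moreover the union of its fibres is bounded. -/
structure IsBoundedPullbackAttractor {N : ℕ} [TopologicalSpace (LC N)] (f : LC N)
    (A : LC N → Set (Phase N)) : Prop extends IsPullbackAttractor f A where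
  isBounded : IsBounded (⋃ g ∈ f.hull, A g)

/-- `𝒜` is a global attractor for the skew-product semiflow on `hull f × ℝ^N`: a nonempty compact
invariant set attracting all compact sets, and the maximal compact invariant set. -/
structure IsGlobalAttractor {N : ℕ} [MetricSpace (LC N)] (f : LC N)
    (𝒜 : Set (LC N × Phase N)) : Prop where
  subset : 𝒜 ⊆ f.hull ×ˢ univ
  nonempty : 𝒜.Nonempty
  isCompact : IsCompact 𝒜
  invariant : ∀ t : ℝ, 0 ≤ t → LC.skewProduct t '' 𝒜 = 𝒜
  attracts : ∀ 𝒟 : Set (LC N × Phase N), 𝒟 ⊆ f.hull ×ˢ univ → 𝒟.Nonempty → IsCompact 𝒟 →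
    Tendsto (fun t : ℝ => hausdorffSemidist (LC.skewProduct t '' 𝒟) 𝒜) atTop (𝓝 0)
  maximal : ∀ 𝒞 : Set (LC N × Phase N), 𝒞 ⊆ f.hull ×ˢ univ → IsCompact 𝒞 →
    (∀ t : ℝ, 0 ≤ t → LC.skewProduct t '' 𝒞 = 𝒞) → 𝒞 ⊆ 𝒜

/-- The fibre `⋂_{τ ≥ 0} cls ⋃_{t ≥ τ} x(t, g_{-t}, B)`. -/
def pullbackFibre {N : ℕ} (B : Set (Phase N)) (g : LC N) : Set (Phase N) :=
  ⋂ τ ∈ Ici (0 : ℝ), closure (⋃ t ∈ Ici τ, LC.sol t (LC.translate (-t) g) '' B)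

/-!
An absorption estimate along the translates of `f` passes to their closure, the hull, with
`closure B` in place of `B`, because each time-`t` solution map is continuous in `g`. The fibres
`pullbackFibre B g` are then pullback `ω`-limits of a cocycle with a compact set that absorbs
uniformly over the base. Compactness turns the limit points of pullback trajectories into
invariance and attraction. For uniqueness, an invariant family with bounded union lies in every
pullback attractor, since the attractor pullback attracts that union.

The skew product is itself a cocycle, over the one-point flow, so when the hull is compact the same
lemmas produce the global attractor. Its fibres are the `pullbackFibre B g` since it is invariant
and contained in `hull f × closure B`. The cocycle property of the solutions is uniqueness of
Carathéodory solutions, that is, Gronwall's lemma with an integrable coefficient.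
-/

section OmegaLimit

open scoped omegaLimit

variable {T α Y Y' : Type*} [TopologicalSpace Y] [TopologicalSpace Y'] {l : Filter T}
  {φ ψ : T → α → Y} {D : Set α} {K : Set Y} {y : Y}

theorem mem_omegaLimit_iff_mapClusterPt :
    y ∈ ω l φ D ↔ MapClusterPt y (l ×ˢ 𝓟 D) (Function.uncurry φ) := by
  simp only [mem_omegaLimit_iff_frequently, mapClusterPt_iff_frequently, Filter.Frequently,
    eventually_prod_principal_iff, Function.uncurry, not_nonempty_iff_eq_empty,
    Set.eq_empty_iff_forall_notMem, mem_inter_iff, mem_preimage, not_and]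

theorem mem_omegaLimit_iff_exists_ultrafilter :
    y ∈ ω l φ D ↔ ∃ U : Ultrafilter (T × α),
      ↑U ≤ l ×ˢ 𝓟 D ∧ Tendsto (Function.uncurry φ) U (𝓝 y) := by
  rw [mem_omegaLimit_iff_mapClusterPt, mapClusterPt_iff_ultrafilter]

theorem mem_omegaLimit_of_frequently_mem_closure (h : ∃ᶠ t in l, y ∈ closure (φ t '' D)) :
    y ∈ ω l φ D :=
  (mem_omegaLimit_iff_frequently₂ l φ D y).2 fun n hn =>
    h.mono fun _ ht => inter_comm n _ ▸ mem_closure_iff_nhds.1 ht n hn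

theorem omegaLimit_subset_of_eventually_mapsTo (hK : IsClosed K)
    (h : ∀ᶠ t in l, MapsTo (φ t) D K) : ω l φ D ⊆ K :=
  (omegaLimit_subset_closure_image2 l φ D h).trans
    (closure_minimal (image2_subset_iff.2 fun _ ht => ht) hK)

theorem omegaLimit_congr (h : ∀ᶠ t in l, EqOn (φ t) (ψ t) D) : ω l φ D = ω l ψ D :=
  Subset.antisymm (mapsTo_omegaLimit' D (mapsTo_id D) h continuous_id)
    (mapsTo_omegaLimit' D (mapsTo_id D) (h.mono fun _ ht => ht.symm) continuous_id)

theorem omegaLimit_comp_time {T' : Type*} (m : T' → T) (l : Filter T') :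
    ω l (fun t => φ (m t)) D = ω (map m l) φ D := by
  ext y
  simp only [mem_omegaLimit_iff_frequently, frequently_map]

theorem omegaLimit_atTop_eq_biInter [Preorder T] [IsDirectedOrder T] [Nonempty T]
    (φ : T → α → Y) (D : Set α) (a : T) :
    ω⁺ φ D = ⋂ τ ∈ Ici a, closure (⋃ t ∈ Ici τ, φ t '' D) := by
  simp only [iUnion_image_left]
  exact (atTop_basis' a).biInter_mem fun _ _ h => closure_mono (image2_subset_right h)

theorem image_omegaLimit [T2Space Y] [T2Space Y'] {h : Y → Y'} (hK : IsCompact K)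
    (hh : ContinuousOn h K) (hφ : ∀ᶠ t in l, MapsTo (φ t) D K) :
    h '' ω l φ D = ω l (fun t x => h (φ t x)) D := by
  have hφK : ∀ {U : Ultrafilter (T × α)}, ↑U ≤ l ×ˢ 𝓟 D →
      ∀ᶠ q in (U : Filter (T × α)), Function.uncurry φ q ∈ K :=
    fun hU => hU (eventually_prod_principal_iff.2 hφ)
  have hlim : ∀ {U : Ultrafilter (T × α)} {x : Y}, ↑U ≤ l ×ˢ 𝓟 D → x ∈ K →
      Tendsto (Function.uncurry φ) U (𝓝 x) →
      Tendsto (fun q : T × α => h (φ q.1 q.2)) U (𝓝 (h x)) := fun hU hx hUx =>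
    (hh _ hx).tendsto.comp (tendsto_nhdsWithin_iff.2 ⟨hUx, hφK hU⟩)
  refine Subset.antisymm ?_ fun z hz => ?_
  · rintro _ ⟨x, hx, rfl⟩
    have hxK := omegaLimit_subset_of_eventually_mapsTo hK.isClosed hφ hx
    obtain ⟨U, hU, hUx⟩ := mem_omegaLimit_iff_exists_ultrafilter.1 hx
    exact mem_omegaLimit_iff_exists_ultrafilter.2 ⟨U, hU, hlim hU hxK hUx⟩
  · obtain ⟨U, hU, hUz⟩ := mem_omegaLimit_iff_exists_ultrafilter.1 hz
    obtain ⟨x, hxK, hUx⟩ := hK.ultrafilter_le_nhds' (U.map (Function.uncurry φ)) (hφK hU)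
    exact ⟨x, mem_omegaLimit_iff_exists_ultrafilter.2 ⟨U, hU, hUx⟩,
      tendsto_nhds_unique (hlim hU hxK hUx) hUz⟩

end OmegaLimit

section HausdorffSemidist

open scoped omegaLimit

variable {T α Y : Type*} {l : Filter T}

theorem hausdorffSemidist_le_iff [PseudoEMetricSpace Y] {S A : Set Y} {r : ℝ≥0∞} :
    hausdorffSemidist S A ≤ r ↔ ∀ y ∈ S, Metric.infEDist y A ≤ r :=
  iSup₂_le_iff

theorem tendsto_hausdorffSemidist_of_omegaLimit_subset [EMetricSpace Y] {φ : T → α → Y}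
    {D : Set α} {K A : Set Y} (hK : IsCompact K) (hφ : ∀ᶠ t in l, MapsTo (φ t) D K)
    (hA : ω l φ D ⊆ A) : Tendsto (fun t => hausdorffSemidist (φ t '' D) A) l (𝓝 0) := by
  refine ENNReal.tendsto_nhds_zero.2 fun ε hε => ?_
  have hU : IsOpen {y | Metric.infEDist y A < ε} :=
    isOpen_lt Metric.continuous_infEDist continuous_const
  have hAU : A ⊆ {y | Metric.infEDist y A < ε} := fun y hy => by
    simpa only [mem_ofPred_eq, Metric.infEDist_zero_of_mem hy] using hε
  filter_upwards [eventually_mapsTo_of_isCompact_absorbing_of_isOpen_of_omegaLimit_subset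
    l φ D hK hφ hU (hA.trans hAU)] with t ht
  exact hausdorffSemidist_le_iff.2 (forall_mem_image.2 fun x hx => (ht hx).le)

theorem subset_of_tendsto_hausdorffSemidist [PseudoEMetricSpace Y] [l.NeBot] {S : T → Set Y}
    {A C : Set Y} (hA : IsClosed A) (h : Tendsto (fun t => hausdorffSemidist (S t) A) l (𝓝 0))
    (hC : ∀ᶠ t in l, C ⊆ S t) : C ⊆ A := fun y hy =>
  (Metric.mem_iff_infEDist_zero_of_closed hA).2 <| le_antisymm
    (ge_of_tendsto h (hC.mono fun _ ht => hausdorffSemidist_le_iff.1 le_rfl y (ht hy))) zero_le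

end HausdorffSemidist

section Cocycle

open scoped omegaLimit

variable {T P Y : Type*}

/-- The skew-product map at time `t` of a cocycle `φ` over `θ`. -/
def skewMap (θ : T → P → P) (φ : T → P → Y → Y) (t : T) (q : P × Y) : P × Y :=
  (θ t q.1, φ t q.1 q.2)

section Absorption

variable [Preorder T] {θ : T → P → P} {φ : T → P → Y → Y} {H : Set P} {D D' K : Set Y}

/-- `K` absorbs `D` in a time that is uniform over the base points in `H`. -/
def UniformlyAbsorbs (φ : T → P → Y → Y) (H : Set P) (D K : Set Y) : Prop :=
  ∀ᶠ t in atTop, ∀ p ∈ H, MapsTo (φ t p) D K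

theorem UniformlyAbsorbs.mono_left (h : UniformlyAbsorbs φ H D K) (hD : D' ⊆ D) :
    UniformlyAbsorbs φ H D' K :=
  Eventually.mono h fun _ ht p hp => (ht p hp).mono_left hD

theorem UniformlyAbsorbs.closure [TopologicalSpace P] [TopologicalSpace Y]
    (h : UniformlyAbsorbs φ H D K)
    (hc : ∀ᶠ t in atTop, ∀ y ∈ D, ContinuousOn (fun p => φ t p y) (closure H)) :
    UniformlyAbsorbs φ (closure H) D (closure K) := by
  filter_upwards [h, hc] with t ht hct p hp y hy
  have hmaps : MapsTo (fun p => φ t p y) H K := fun p hp => ht p hp hy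
  exact closure_mono hmaps.image_subset ((hct y hy).image_closure (mem_image_of_mem _ hp))

theorem UniformlyAbsorbs.skewMap (hD : UniformlyAbsorbs φ H D K) (hθ : ∀ t, MapsTo (θ t) H H) :
    UniformlyAbsorbs (fun t (_ : Unit) => skewMap θ φ t) univ (H ×ˢ D) (H ×ˢ K) :=
  Eventually.mono hD fun t ht _ _ q hq => ⟨hθ t hq.1, ht q.1 hq.1 hq.2⟩

end Absorption

variable [AddCommGroup T] [LinearOrder T]

/-- `φ` is a cocycle on `Z ⊆ Y` over the flow `θ` on `H ⊆ P`, continuous in the fibre variable.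
The flow is two-sided in time, while `φ t` is constrained only for `t ≥ 0`. A semiflow is a cocycle
over the one-point flow. -/
structure IsCocycleOn [TopologicalSpace Y] (θ : T → P → P) (φ : T → P → Y → Y) (H : Set P)
    (Z : Set Y) : Prop where
  mapsTo_flow : ∀ t, MapsTo (θ t) H H
  flow_zero : ∀ p ∈ H, θ 0 p = p
  flow_add : ∀ s t, ∀ p ∈ H, θ (s + t) p = θ s (θ t p)
  mapsTo : ∀ t, 0 ≤ t → ∀ p ∈ H, MapsTo (φ t p) Z Z
  continuousOn : ∀ t, 0 ≤ t → ∀ p ∈ H, ContinuousOn (φ t p) Z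
  map_add : ∀ s t, 0 ≤ s → 0 ≤ t → ∀ p ∈ H, ∀ y ∈ Z, φ (s + t) p y = φ s (θ t p) (φ t p y)

/-- The pullback `ω`-limit of `D` at the base point `p`: the limit points at `p` of trajectories
issued from `D` at a time that recedes to `-∞`. For the one-point flow it is the `ω`-limit. -/
def pullbackLimit [TopologicalSpace Y] (θ : T → P → P) (φ : T → P → Y → Y) (D : Set Y) (p : P) :
    Set Y :=
  ω⁺ (fun t => φ t (θ (-t) p)) D

variable {θ : T → P → P} {φ : T → P → Y → Y} {H : Set P} {Z B D K : Set Y} {p : P}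

namespace IsCocycleOn

section TopologicalSpace

variable [TopologicalSpace Y]

theorem flow_neg_flow (hφ : IsCocycleOn θ φ H Z) (t : T) (hp : p ∈ H) : θ (-t) (θ t p) = p := by
  rw [← hφ.flow_add _ _ p hp, neg_add_cancel, hφ.flow_zero p hp]

theorem flow_flow_neg (hφ : IsCocycleOn θ φ H Z) (t : T) (hp : p ∈ H) : θ t (θ (-t) p) = p := by
  rw [← hφ.flow_add _ _ p hp, add_neg_cancel, hφ.flow_zero p hp]

theorem eventually_mapsTo_pullback (hφ : IsCocycleOn θ φ H Z) (hD : UniformlyAbsorbs φ H D K)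
    (hp : p ∈ H) : ∀ᶠ t in atTop, MapsTo (φ t (θ (-t) p)) D K :=
  Eventually.mono hD fun t ht => ht _ (hφ.mapsTo_flow (-t) hp)

theorem pullbackLimit_subset (hφ : IsCocycleOn θ φ H Z) (hD : UniformlyAbsorbs φ H D K)
    (hK : IsClosed K) (hp : p ∈ H) : pullbackLimit θ φ D p ⊆ K :=
  omegaLimit_subset_of_eventually_mapsTo hK (hφ.eventually_mapsTo_pullback hD hp)

theorem isCompact_pullbackLimit [T2Space Y] (hφ : IsCocycleOn θ φ H Z)
    (hD : UniformlyAbsorbs φ H D K) (hK : IsCompact K) (hp : p ∈ H) :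
    IsCompact (pullbackLimit θ φ D p) :=
  hK.of_isClosed_subset (isClosed_omegaLimit _ _ _) (hφ.pullbackLimit_subset hD hK.isClosed hp)

theorem pullbackLimit_nonempty [T2Space Y] (hφ : IsCocycleOn θ φ H Z)
    (hD : UniformlyAbsorbs φ H D K) (hK : IsCompact K) (hne : D.Nonempty) (hp : p ∈ H) :
    (pullbackLimit θ φ D p).Nonempty :=
  nonempty_omegaLimit_of_isCompact_absorbing _ _ _ hK
    ⟨_, hφ.eventually_mapsTo_pullback hD hp,
      closure_minimal (image2_subset_iff.2 fun _ ht => ht) hK.isClosed⟩ hne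

theorem subset_pullbackLimit (hφ : IsCocycleOn θ φ H Z) (hBZ : closure B ⊆ Z) (hp : p ∈ H)
    {C : Set Y} (hC : ∀ t, 0 ≤ t → C ⊆ φ t (θ (-t) p) '' closure B) :
    C ⊆ pullbackLimit θ φ B p := fun _ hy =>
  mem_omegaLimit_of_frequently_mem_closure <| ((eventually_ge_atTop 0).mono fun t ht =>
    ((hφ.continuousOn t ht _ (hφ.mapsTo_flow (-t) hp)).mono hBZ).image_closure
      (hC t ht hy)).frequently

variable [IsOrderedAddMonoid T]

theorem image_pullbackLimit [T2Space Y] (hφ : IsCocycleOn θ φ H Z) (hD : UniformlyAbsorbs φ H D K)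
    (hDZ : D ⊆ Z) (hK : IsCompact K) (hKZ : K ⊆ Z) {t : T} (ht : 0 ≤ t) (hp : p ∈ H) :
    φ t p '' pullbackLimit θ φ D p = pullbackLimit θ φ D (θ t p) := by
  have hshift : ∀ s, 0 ≤ s → EqOn (fun y => φ t p (φ s (θ (-s) p) y))
      (φ (t + s) (θ (-(t + s)) (θ t p))) D := fun s hs y hy => by
    have hbase : θ (-(t + s)) (θ t p) = θ (-s) p := by
      rw [neg_add_rev, hφ.flow_add _ _ _ (hφ.mapsTo_flow t hp), hφ.flow_neg_flow t hp]
    rw [hbase, hφ.map_add t s ht hs _ (hφ.mapsTo_flow (-s) hp) y (hDZ hy), hφ.flow_flow_neg s hp]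
  calc φ t p '' pullbackLimit θ φ D p
      = ω⁺ (fun s y => φ t p (φ s (θ (-s) p) y)) D :=
        image_omegaLimit hK ((hφ.continuousOn t ht p hp).mono hKZ)
          (hφ.eventually_mapsTo_pullback hD hp)
    _ = ω⁺ (fun s => φ (t + s) (θ (-(t + s)) (θ t p))) D :=
        omegaLimit_congr ((eventually_ge_atTop 0).mono hshift)
    _ = ω (map (t + ·) atTop) (fun s => φ s (θ (-s) (θ t p))) D :=
        omegaLimit_comp_time (φ := fun s => φ s (θ (-s) (θ t p))) (t + ·) atTop
    _ = pullbackLimit θ φ D (θ t p) := by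
        rw [show map (t + ·) atTop = atTop from (OrderIso.addLeft t).map_atTop, pullbackLimit]

/- By invariance the limit at `p` is the image at time `t` of the limit at `θ (-t) p`, which lies
in `closure B`. -/
theorem pullbackLimit_subset_pullbackLimit [T2Space Y] (hφ : IsCocycleOn θ φ H Z)
    (hD : UniformlyAbsorbs φ H D (closure B)) (hDZ : D ⊆ Z) (hB : IsCompact (closure B))
    (hBZ : closure B ⊆ Z) (hp : p ∈ H) : pullbackLimit θ φ D p ⊆ pullbackLimit θ φ B p := by
  refine hφ.subset_pullbackLimit hBZ hp fun t ht => ?_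
  have hp' := hφ.mapsTo_flow (-t) hp
  have hinv := hφ.image_pullbackLimit hD hDZ hB hBZ ht hp'
  rw [hφ.flow_flow_neg t hp] at hinv
  exact hinv ▸ image_mono (hφ.pullbackLimit_subset hD isClosed_closure hp')

end TopologicalSpace

theorem tendsto_hausdorffSemidist_pullbackLimit [IsOrderedAddMonoid T] [EMetricSpace Y]
    (hφ : IsCocycleOn θ φ H Z) (hD : UniformlyAbsorbs φ H D (closure B)) (hDZ : D ⊆ Z)
    (hB : IsCompact (closure B)) (hBZ : closure B ⊆ Z) (hp : p ∈ H) :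
    Tendsto (fun t => hausdorffSemidist (φ t (θ (-t) p) '' D) (pullbackLimit θ φ B p))
      atTop (𝓝 0) :=
  tendsto_hausdorffSemidist_of_omegaLimit_subset hB (hφ.eventually_mapsTo_pullback hD hp)
    (hφ.pullbackLimit_subset_pullbackLimit hD hDZ hB hBZ hp)

end IsCocycleOn

section SkewProduct

variable [TopologicalSpace P] [TopologicalSpace Y]

theorem isCocycleOn_skewMap (hφ : IsCocycleOn θ φ H Z)
    (hc : ∀ t, 0 ≤ t → ContinuousOn (skewMap θ φ t) (H ×ˢ Z)) :
    IsCocycleOn (fun _ u => u) (fun t (_ : Unit) => skewMap θ φ t) univ (H ×ˢ Z) where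
  mapsTo_flow _ := mapsTo_univ _ _
  flow_zero _ _ := rfl
  flow_add _ _ _ _ := rfl
  mapsTo t ht _ _ _ hq := ⟨hφ.mapsTo_flow t hq.1, hφ.mapsTo t ht _ hq.1 hq.2⟩
  continuousOn t ht _ _ := hc t ht
  map_add s t hs ht _ _ q hq :=
    Prod.ext (hφ.flow_add s t q.1 hq.1) (hφ.map_add s t hs ht q.1 hq.1 q.2 hq.2)

theorem prod_pullbackLimit_subset_omegaLimit_skewMap (hφ : IsCocycleOn θ φ H Z) (hp : p ∈ H) :
    {p} ×ˢ pullbackLimit θ φ D p ⊆ ω⁺ (skewMap θ φ) (H ×ˢ D) := by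
  rintro ⟨p', y⟩ ⟨(rfl : p' = p), hy⟩
  refine (mem_omegaLimit_iff_frequently _ _ _ _).2 fun n hn => ?_
  have hn' := (Continuous.prodMk_right p').continuousAt.preimage_mem_nhds hn
  refine ((mem_omegaLimit_iff_frequently _ _ _ _).1 hy _ hn').mono ?_
  rintro t ⟨z, hz, hzn⟩
  refine ⟨(θ (-t) p', z), ⟨hφ.mapsTo_flow (-t) hp, hz⟩, ?_⟩
  simpa only [mem_preimage, skewMap, hφ.flow_flow_neg t hp] using hzn

theorem omegaLimit_skewMap [IsOrderedAddMonoid T] [T2Space P] [T2Space Y]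
    (hφ : IsCocycleOn θ φ H Z) (hc : ∀ t, 0 ≤ t → ContinuousOn (skewMap θ φ t) (H ×ˢ Z))
    (hH : IsCompact H) (hB : IsCompact (closure B)) (hBZ : closure B ⊆ Z)
    (hBB : UniformlyAbsorbs φ H B (closure B)) :
    ω⁺ (skewMap θ φ) (H ×ˢ B) = ⋃ p ∈ H, {p} ×ˢ pullbackLimit θ φ B p := by
  have hskew := isCocycleOn_skewMap hφ hc
  have hskewB := hBB.skewMap hφ.mapsTo_flow
  have hsub : ω⁺ (skewMap θ φ) (H ×ˢ B) ⊆ H ×ˢ closure B :=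
    hskew.pullbackLimit_subset hskewB (hH.isClosed.prod isClosed_closure) (mem_univ ())
  refine Subset.antisymm ?_ (iUnion₂_subset fun p hp =>
    prod_pullbackLimit_subset_omegaLimit_skewMap hφ hp)
  rintro ⟨p, y⟩ hq
  have hp := (hsub hq).1
  refine mem_biUnion hp ⟨rfl, hφ.subset_pullbackLimit hBZ hp (C := {y}) ?_ rfl⟩
  rintro t ht _ rfl
  have hinv : skewMap θ φ t '' ω⁺ (skewMap θ φ) (H ×ˢ B) = ω⁺ (skewMap θ φ) (H ×ˢ B) :=
    hskew.image_pullbackLimit hskewB (prod_mono_right (subset_closure.trans hBZ)) (hH.prod hB)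
      (prod_mono_right hBZ) ht (mem_univ ())
  rw [← hinv] at hq
  obtain ⟨⟨p', z⟩, hz, hpz⟩ := hq
  obtain ⟨rfl, rfl⟩ := Prod.ext_iff.1 hpz
  refine ⟨z, (hsub hz).2, ?_⟩
  simp only [skewMap, hφ.flow_neg_flow t (hsub hz).1]

end SkewProduct

end Cocycle

section Gronwall

variable {u l : ℝ → ℝ} {a b : ℝ}

/- At a maximum point `m` of `u` the hypothesis reads `u m ≤ u m * ∫ s in a..m, l s`. -/
theorem eqOn_zero_of_le_integral_mul_of_integral_lt_one (hu : ContinuousOn u (Icc a b))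
    (hu₀ : ∀ t ∈ Icc a b, 0 ≤ u t) (hl : IntervalIntegrable l volume a b)
    (hl₀ : ∀ t ∈ Icc a b, 0 ≤ l t) (hl₁ : ∫ s in a..b, l s < 1)
    (h : ∀ t ∈ Icc a b, u t ≤ ∫ s in a..t, l s * u s) : EqOn u 0 (Icc a b) := by
  intro t ht
  have hab := ht.1.trans ht.2
  obtain ⟨m, hm, hmax⟩ := isCompact_Icc.exists_isMaxOn (nonempty_Icc.2 hab) hu
  have hm_sub : Icc a m ⊆ Icc a b := Icc_subset_Icc_right hm.2
  have hl_am : IntervalIntegrable l volume a m := hl.mono_set (by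
    simpa only [uIcc_of_le hab, uIcc_of_le hm.1] using hm_sub)
  have hint_le : ∫ s in a..m, l s ≤ ∫ s in a..b, l s :=
    intervalIntegral.integral_mono_interval le_rfl hm.1 hm.2
      (ae_restrict_of_forall_mem measurableSet_Ioc fun s hs => hl₀ s (Ioc_subset_Icc_self hs)) hl
  have hum : u m ≤ u m * ∫ s in a..m, l s := calc
    u m ≤ ∫ s in a..m, l s * u s := h m hm
    _ ≤ ∫ s in a..m, l s * u m :=
      intervalIntegral.integral_mono_on hm.1
        (hl_am.mul_continuousOn (hu.mono (uIcc_of_le hm.1 ▸ hm_sub))) (hl_am.mul_const _)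
        fun s hs => mul_le_mul_of_nonneg_left (hmax (hm_sub hs)) (hl₀ s (hm_sub hs))
    _ = u m * ∫ s in a..m, l s := by rw [intervalIntegral.integral_mul_const, mul_comm]
  have hum₀ : u m ≤ 0 := by nlinarith
  exact le_antisymm ((hmax ht).trans hum₀) (hu₀ t ht)

theorem eqOn_zero_of_le_add_integral_mul (hu : ContinuousOn u (Icc a b))
    (hu₀ : ∀ t ∈ Icc a b, 0 ≤ u t) (hua : u a = 0) (hl : IntervalIntegrable l volume a b)
    (hl₀ : ∀ t ∈ Icc a b, 0 ≤ l t)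
    (h : ∀ c d, a ≤ c → c ≤ d → d ≤ b → u d ≤ u c + ∫ s in c..d, l s * u s) :
    EqOn u 0 (Icc a b) := by
  refine IsClosed.Icc_subset_of_forall_exists_gt (s := {t | u t = 0}) ?_ hua ?_
  · rw [inter_comm]
    exact hu.preimage_isClosed_of_isClosed isClosed_Icc isClosed_singleton
  rintro c ⟨hc, hac, hcb⟩ y hy
  have hab := hac.trans hcb.le
  have hcont : ContinuousWithinAt (fun d => ∫ s in c..d, l s) (Icc a b) c :=
    uIcc_of_le hab ▸ intervalIntegral.continuousOn_primitive_interval' hl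
      (uIcc_of_le hab ▸ ⟨hac, hcb.le⟩) c (uIcc_of_le hab ▸ ⟨hac, hcb.le⟩)
  have hsmall : ∀ᶠ d in 𝓝[>] c, ∫ s in c..d, l s < 1 := by
    refine (hcont.mono_left ?_).eventually_lt_const ?_
    · exact nhdsWithin_le_iff.2 (mem_of_superset (Ioc_mem_nhdsGT hcb)
        fun s hs => ⟨hac.trans hs.1.le, hs.2⟩)
    · simp only [intervalIntegral.integral_same, zero_lt_one]
  obtain ⟨d, hd₁, hcd, hd⟩ := (hsmall.and (Ioc_mem_nhdsGT (lt_min hy hcb))).exists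
  have hdb := hd.trans (min_le_right _ _)
  have hsub : Icc c d ⊆ Icc a b := Icc_subset_Icc hac hdb
  have hzero : EqOn u 0 (Icc c d) := eqOn_zero_of_le_integral_mul_of_integral_lt_one
    (hu.mono hsub) (fun t ht => hu₀ t (hsub ht))
    (hl.mono_set (by simpa only [uIcc_of_le hab, uIcc_of_le hcd.le] using hsub))
    (fun t ht => hl₀ t (hsub ht)) hd₁ fun t ht => by
      simpa only [show u c = 0 from hc, zero_add] using h c t hac ht.1 (ht.2.trans hdb)
  exact ⟨d, hzero ⟨hcd.le, le_rfl⟩, hcd, hd.trans (min_le_left _ _)⟩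

end Gronwall

section Caratheodory

variable {N : ℕ}

namespace IsLipschitzCaratheodory

variable {F G : ℝ × Phase N → Phase N}

theorem ae_continuous (hF : IsLipschitzCaratheodory F) :
    ∀ᵐ t : ℝ, Continuous fun x => F (t, x) := by
  have hball : ∀ n : ℕ, ∀ᵐ t : ℝ, ContinuousOn (fun x => F (t, x)) (Metric.closedBall 0 n) := by
    intro n
    obtain ⟨l, -, hl⟩ := hF.lbound _ (isCompact_closedBall 0 n)
    filter_upwards [hl] with t ht
    refine (LipschitzOnWith.of_dist_le_mul (K := (l t).toNNReal) fun x hx y hy => ?_).continuousOn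
    simpa only [dist_eq_norm] using (ht x hx y hy).trans
      (mul_le_mul_of_nonneg_right (Real.le_coe_toNNReal _) (norm_nonneg _))
  filter_upwards [ae_all_iff.2 hball] with t ht
  refine continuous_iff_continuousAt.2 fun x => ?_
  obtain ⟨n, hn⟩ := exists_nat_gt ‖x‖
  exact (ht n).continuousAt (Metric.closedBall_mem_nhds_of_mem (mem_ball_zero_iff.2 hn))

theorem ae_forall_eq (hF : IsLipschitzCaratheodory F) (hG : IsLipschitzCaratheodory G)
    (h : F =ᵐ[volume] G) : ∀ᵐ t : ℝ, ∀ x, F (t, x) = G (t, x) := by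
  filter_upwards [hF.ae_continuous, hG.ae_continuous, Measure.ae_ae_of_ae_prod h]
    with t hFt hGt hFG
  exact congrFun ((hFt.ae_eq_iff_eq volume hGt).1 hFG)

end IsLipschitzCaratheodory

namespace LC

theorem isLipschitzCaratheodory_rep (g : LC N) : IsLipschitzCaratheodory g.rep :=
  (Quotient.out g).2

theorem translate_zero (g : LC N) : translate 0 g = g := by
  induction g using Quotient.inductionOn
  exact Quotient.sound (s := LCFun.setoid N) (ae_of_all _ fun p => by simp only [add_zero])

theorem translate_add (s t : ℝ) (g : LC N) :
    translate (s + t) g = translate s (translate t g) := by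
  induction g using Quotient.inductionOn
  exact Quotient.sound (s := LCFun.setoid N) (ae_of_all _ fun p => by simp only [add_assoc])

theorem ae_rep_translate (s : ℝ) (g : LC N) :
    ∀ᵐ r : ℝ, ∀ x, (translate s g).rep (r, x) = g.rep (r + s, x) := by
  refine (translate s g).isLipschitzCaratheodory_rep.ae_forall_eq
    (g.isLipschitzCaratheodory_rep.timeShift s) ?_
  have hmk : translate s g = Quotient.mk (LCFun.setoid N)
      ⟨fun p => g.rep (p.1 + s, p.2), g.isLipschitzCaratheodory_rep.timeShift s⟩ := by
    conv_lhs => rw [← Quotient.out_eq g]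
    rfl
  rw [hmk]
  exact Quotient.mk_out (s := LCFun.setoid N) _

variable {g : LC N} {x₀ y₀ : Phase N} {x y : ℝ → Phase N}

namespace IsSolution

theorem intervalIntegrable (hx : g.IsSolution x₀ x) {c d : ℝ} (hc : 0 ≤ c) (hd : 0 ≤ d) :
    IntervalIntegrable (fun s => g.rep (s, x s)) volume c d :=
  (hx.2 c hc).1.symm.trans (hx.2 d hd).1

theorem eq_add_integral (hx : g.IsSolution x₀ x) {c d : ℝ} (hc : 0 ≤ c) (hd : 0 ≤ d) :
    x d = x c + ∫ s in c..d, g.rep (s, x s) := by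
  rw [(hx.2 c hc).2, (hx.2 d hd).2, add_assoc,
    intervalIntegral.integral_add_adjacent_intervals (hx.2 c hc).1 (hx.intervalIntegrable hc hd)]

theorem apply_zero (hx : g.IsSolution x₀ x) : x 0 = x₀ := by
  simpa only [intervalIntegral.integral_same, add_zero] using (hx.2 0 le_rfl).2

theorem sub_eq_add_integral (hx : g.IsSolution x₀ x) (hy : g.IsSolution y₀ y) {c d : ℝ}
    (hc : 0 ≤ c) (hd : 0 ≤ d) :
    x d - y d = (x c - y c) + ∫ s in c..d, (g.rep (s, x s) - g.rep (s, y s)) := by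
  rw [intervalIntegral.integral_sub (hx.intervalIntegrable hc hd) (hy.intervalIntegrable hc hd),
    hx.eq_add_integral hc hd, hy.eq_add_integral hc hd]
  abel

theorem exists_norm_sub_le_add_integral (hx : g.IsSolution x₀ x) (hy : g.IsSolution y₀ y) (b : ℝ) :
    ∃ l : ℝ → ℝ, LocallyIntegrable l volume ∧ (∀ s, 0 ≤ l s) ∧ ∀ c d, 0 ≤ c → c ≤ d → d ≤ b →
      ‖x d - y d‖ ≤ ‖x c - y c‖ + ∫ s in c..d, l s * ‖x s - y s‖ := by
  have hxb : ContinuousOn x (Icc 0 b) := hx.1.mono Icc_subset_Ici_self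
  have hyb : ContinuousOn y (Icc 0 b) := hy.1.mono Icc_subset_Ici_self
  obtain ⟨l, hl, hle⟩ := g.isLipschitzCaratheodory_rep.lbound _
    ((isCompact_Icc.image_of_continuousOn hxb).union (isCompact_Icc.image_of_continuousOn hyb))
  have hl' : LocallyIntegrable (fun s => |l s|) volume := fun s => (hl s).norm
  refine ⟨fun s => |l s|, hl', fun s => abs_nonneg _, fun c d hc hcd hdb => ?_⟩
  have hint : IntervalIntegrable (fun s => |l s| * ‖x s - y s‖) volume c d :=
    (hl'.integrableOn_isCompact isCompact_uIcc).intervalIntegrable.mul_continuousOn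
      ((hxb.sub hyb).norm.mono (uIcc_of_le hcd ▸ Icc_subset_Icc hc hdb))
  rw [hx.sub_eq_add_integral hy hc (hc.trans hcd)]
  refine (norm_add_le _ _).trans (add_le_add_right ?_ _)
  refine intervalIntegral.norm_integral_le_of_norm_le hcd ?_ hint
  filter_upwards [hle] with s hs hscd
  have hs' : s ∈ Icc 0 b := ⟨hc.trans hscd.1.le, hscd.2.trans hdb⟩
  exact (hs _ (.inl (mem_image_of_mem x hs')) _ (.inr (mem_image_of_mem y hs'))).trans
    (mul_le_mul_of_nonneg_right (le_abs_self _) (norm_nonneg _))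

theorem unique (hx : g.IsSolution x₀ x) (hy : g.IsSolution x₀ y) {t : ℝ} (ht : 0 ≤ t) :
    x t = y t := by
  obtain ⟨l, hl, hl₀, hle⟩ := hx.exists_norm_sub_le_add_integral hy t
  have hcont : ContinuousOn (fun s => ‖x s - y s‖) (Icc 0 t) :=
    (hx.1.sub hy.1).norm.mono Icc_subset_Ici_self
  have hzero : EqOn (fun s => ‖x s - y s‖) 0 (Icc 0 t) := eqOn_zero_of_le_add_integral_mul
    hcont (fun _ _ => norm_nonneg _) (by rw [hx.apply_zero, hy.apply_zero, sub_self, norm_zero])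
    (hl.integrableOn_isCompact isCompact_uIcc).intervalIntegrable (fun s _ => hl₀ s) hle
  exact sub_eq_zero.1 (norm_eq_zero.1 (hzero ⟨ht, le_rfl⟩))

theorem translate (hx : g.IsSolution x₀ x) {s : ℝ} (hs : 0 ≤ s) :
    (LC.translate s g).IsSolution (x s) fun r => x (r + s) := by
  have hae : ∀ᵐ r : ℝ, (LC.translate s g).rep (r, x (r + s)) = g.rep (r + s, x (r + s)) :=
    (ae_rep_translate s g).mono fun r hr => hr _
  refine ⟨hx.1.comp (by fun_prop) fun r hr => add_nonneg hr hs, fun t ht => ⟨?_, ?_⟩⟩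
  · have hint := (hx.intervalIntegrable hs (add_nonneg ht hs)).comp_add_right s
    simp only [sub_self, add_sub_cancel_right] at hint
    exact hint.congr_ae (ae_restrict_of_ae (hae.mono fun r hr => hr.symm))
  · rw [intervalIntegral.integral_congr_ae (hae.mono fun r hr _ => hr),
      intervalIntegral.integral_comp_add_right (fun r => g.rep (r, x r)), zero_add]
    exact hx.eq_add_integral hs (add_nonneg ht hs)

end IsSolution

theorem isSolution_sol (h : ∃ x, g.IsSolution x₀ x) : g.IsSolution x₀ fun t => sol t g x₀ :=
  Classical.epsilon_spec h

theorem sol_add (h : ∃ x, g.IsSolution x₀ x) {s t : ℝ} (hs : 0 ≤ s) (ht : 0 ≤ t) :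
    sol (s + t) g x₀ = sol s (LC.translate t g) (sol t g x₀) :=
  have hshift := (isSolution_sol h).translate ht
  hshift.unique (isSolution_sol ⟨_, hshift⟩) hs

end LC

end Caratheodory

section Attractors

open scoped omegaLimit

variable {N : ℕ} {B : Set (Phase N)}

theorem pullbackFibre_eq_pullbackLimit :
    pullbackFibre B = pullbackLimit LC.translate LC.sol B :=
  funext fun _ => (omegaLimit_atTop_eq_biInter _ B 0).symm

theorem LC.skewProduct_eq_skewMap :
    LC.skewProduct (N := N) = skewMap LC.translate LC.sol :=
  rfl

section TopologicalSpace

variable [TopologicalSpace (LC N)] {f : LC N}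

theorem LC.self_mem_hull (f : LC N) : f ∈ f.hull :=
  subset_closure ⟨0, f.translate_zero⟩

theorem LC.isCocycleOn_sol (hflow : ∀ t : ℝ, ∀ g ∈ f.hull, LC.translate t g ∈ f.hull)
    (hglobal : ∀ g ∈ f.hull, ∀ x₀ : Phase N, ∃ x : ℝ → Phase N, g.IsSolution x₀ x)
    (hcont : ∀ t : ℝ, 0 ≤ t → ContinuousOn (LC.skewProduct t) (f.hull ×ˢ univ)) :
    IsCocycleOn LC.translate LC.sol f.hull univ where
  mapsTo_flow := hflow
  flow_zero g _ := g.translate_zero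
  flow_add s t g _ := g.translate_add s t
  mapsTo _ _ _ _ := mapsTo_univ _ _
  continuousOn t ht g hg := continuous_snd.comp_continuousOn ((hcont t ht).comp
    (f := fun x => (g, x)) (by fun_prop) fun _ _ => ⟨hg, mem_univ _⟩)
  map_add _ _ hs ht g hg x _ := LC.sol_add (hglobal g hg x) hs ht

theorem LC.uniformlyAbsorbs_sol_hull {D : Set (Phase N)}
    (hcont : ∀ t : ℝ, 0 ≤ t → ContinuousOn (LC.skewProduct t) (f.hull ×ˢ univ))
    (hD : UniformlyAbsorbs LC.sol (range fun s => LC.translate s f) D B) :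
    UniformlyAbsorbs LC.sol f.hull D (closure B) :=
  hD.closure <| (eventually_ge_atTop 0).mono fun t ht x _ =>
    continuous_snd.comp_continuousOn ((hcont t ht).comp
      (f := fun g => (g, x)) (by fun_prop) fun _ hg => ⟨hg, mem_univ _⟩)

theorem isBoundedPullbackAttractor_pullbackFibre
    (hφ : IsCocycleOn LC.translate LC.sol f.hull univ) (hB : IsBounded B) (hne : B.Nonempty)
    (habs : ∀ D, IsBounded D → UniformlyAbsorbs LC.sol f.hull D (closure B)) :
    IsBoundedPullbackAttractor f (pullbackFibre B) := by
  have hBc := hB.isCompact_closure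
  rw [pullbackFibre_eq_pullbackLimit]
  exact
    { nonempty := fun g hg => hφ.pullbackLimit_nonempty (habs B hB) hBc hne hg
      isCompact := fun g hg => hφ.isCompact_pullbackLimit (habs B hB) hBc hg
      invariant := fun t ht g hg =>
        hφ.image_pullbackLimit (habs B hB) (subset_univ _) hBc (subset_univ _) ht hg
      attracts := fun D _ hD g hg => hφ.tendsto_hausdorffSemidist_pullbackLimit (habs D hD)
        (subset_univ _) hBc (subset_univ _) hg
      isBounded := hBc.isBounded.subset (iUnion₂_subset fun g hg =>
        hφ.pullbackLimit_subset (habs B hB) isClosed_closure hg) }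

/- `A g` is the image at time `t` of a fibre of `A`, hence of the bounded union of all fibres, which
`A'` pullback attracts. -/
theorem IsBoundedPullbackAttractor.subset {A A' : LC N → Set (Phase N)}
    (hA : IsBoundedPullbackAttractor f A) (hA' : IsPullbackAttractor f A')
    (hflow : ∀ t : ℝ, ∀ g ∈ f.hull, LC.translate t g ∈ f.hull) {g : LC N} (hg : g ∈ f.hull) :
    A g ⊆ A' g := by
  have hne : (⋃ g ∈ f.hull, A g).Nonempty := (hA.nonempty g hg).mono (subset_biUnion_of_mem hg)
  refine subset_of_tendsto_hausdorffSemidist (hA'.isCompact g hg).isClosed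
    (hA'.attracts _ hne hA.isBounded g hg) ((eventually_ge_atTop 0).mono fun t ht => ?_)
  have hinv := hA.invariant t ht _ (hflow (-t) g hg)
  rw [← LC.translate_add, add_neg_cancel, LC.translate_zero] at hinv
  exact hinv ▸ image_mono (subset_biUnion_of_mem (u := A) (hflow (-t) g hg))

end TopologicalSpace

theorem isGlobalAttractor_omegaLimit [MetricSpace (LC N)] {f : LC N}
    (hφ : IsCocycleOn LC.translate LC.sol f.hull univ)
    (hcont : ∀ t : ℝ, 0 ≤ t → ContinuousOn (LC.skewProduct t) (f.hull ×ˢ univ))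
    (hH : IsCompact f.hull) (hB : IsBounded B) (hne : B.Nonempty)
    (habs : ∀ D, IsBounded D → UniformlyAbsorbs LC.sol f.hull D (closure B)) :
    IsGlobalAttractor f (ω⁺ LC.skewProduct (f.hull ×ˢ B)) := by
  have hskew := isCocycleOn_skewMap hφ hcont
  have hcl : f.hull ×ˢ closure B = closure (f.hull ×ˢ B) := by
    rw [closure_prod_eq, hH.isClosed.closure_eq]
  have hHB : IsCompact (closure (f.hull ×ˢ B)) := hcl ▸ hH.prod hB.isCompact_closure
  have hZ : closure (f.hull ×ˢ B) ⊆ f.hull ×ˢ univ := hcl ▸ prod_mono_right (subset_univ _)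
  have habs' := fun D hD => hcl ▸ (habs D hD).skewMap hφ.mapsTo_flow
  have hattr : ∀ 𝒟 : Set (LC N × Phase N), 𝒟 ⊆ f.hull ×ˢ univ → IsCompact 𝒟 →
      Tendsto (fun t : ℝ => hausdorffSemidist (LC.skewProduct t '' 𝒟)
        (ω⁺ LC.skewProduct (f.hull ×ˢ B))) atTop (𝓝 0) := fun 𝒟 h𝒟 hc =>
    hskew.tendsto_hausdorffSemidist_pullbackLimit
      ((habs' (Prod.snd '' 𝒟) (hc.image continuous_snd).isBounded).mono_left
        fun q hq => ⟨(h𝒟 hq).1, mem_image_of_mem _ hq⟩) h𝒟 hHB hZ (mem_univ ())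
  have hcompact : IsCompact (ω⁺ LC.skewProduct (f.hull ×ˢ B)) :=
    hskew.isCompact_pullbackLimit (habs' B hB) hHB (mem_univ ())
  exact
    { subset := (hskew.pullbackLimit_subset (habs' B hB) isClosed_closure (mem_univ ())).trans hZ
      nonempty := hskew.pullbackLimit_nonempty (habs' B hB) hHB (.prod ⟨f, f.self_mem_hull⟩ hne)
        (mem_univ ())
      isCompact := hcompact
      invariant := fun t ht => hskew.image_pullbackLimit (habs' B hB) (subset_closure.trans hZ) hHB
        hZ ht (mem_univ ())
      attracts := fun 𝒟 h𝒟 _ hc => hattr 𝒟 h𝒟 hc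
      maximal := fun 𝒞 h𝒞 hc hinv => subset_of_tendsto_hausdorffSemidist hcompact.isClosed
        (hattr 𝒞 h𝒞 hc) ((eventually_ge_atTop 0).mono fun t ht => (hinv t ht).superset) }

end Attractors

theorem mainTheorem10_general (N : ℕ) [MetricSpace (LC N)] (f : LC N)
    (hflow : ∀ t : ℝ, ∀ g ∈ f.hull, LC.translate t g ∈ f.hull)
    (hglobal : ∀ g ∈ f.hull, ∀ x₀ : Phase N, ∃ x : ℝ → Phase N, g.IsSolution x₀ x)
    (hcont : ∀ t : ℝ, 0 ≤ t → ContinuousOn (LC.skewProduct t) (f.hull ×ˢ univ))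
    (B : Set (Phase N)) (hB : IsBounded B)
    (habsorb : ∀ D : Set (Phase N), D.Nonempty → IsBounded D →
      ∃ T : ℝ, 0 ≤ T ∧ ∀ s t : ℝ, T ≤ t → LC.sol t (LC.translate s f) '' D ⊆ B) :
    (IsBoundedPullbackAttractor f (pullbackFibre B) ∧
      ∀ A : LC N → Set (Phase N), IsBoundedPullbackAttractor f A →
        ∀ g ∈ f.hull, A g = pullbackFibre B g) ∧
    (IsCompact f.hull →
      IsGlobalAttractor f
        (⋂ τ ∈ Ici (0 : ℝ), closure (⋃ t ∈ Ici τ, LC.skewProduct t '' (f.hull ×ˢ B))) ∧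
      (⋂ τ ∈ Ici (0 : ℝ), closure (⋃ t ∈ Ici τ, LC.skewProduct t '' (f.hull ×ˢ B))) =
        ⋃ g ∈ f.hull, {g} ×ˢ pullbackFibre B g) := by
  have hφ := LC.isCocycleOn_sol hflow hglobal hcont
  have hne : B.Nonempty := by
    obtain ⟨T, -, hT⟩ := habsorb {0} (singleton_nonempty _) isBounded_singleton
    exact ((singleton_nonempty (0 : Phase N)).image _).mono (hT 0 T le_rfl)
  have habs : ∀ D, IsBounded D → UniformlyAbsorbs LC.sol f.hull D (closure B) := fun D hD => by
    rcases D.eq_empty_or_nonempty with rfl | hDne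
    · exact .of_forall fun t g _ => mapsTo_empty _ _
    obtain ⟨T, -, hT⟩ := habsorb D hDne hD
    exact LC.uniformlyAbsorbs_sol_hull hcont <| (eventually_ge_atTop T).mono fun t ht =>
      forall_mem_range.2 fun s => mapsTo_iff_image_subset.2 (hT s t ht)
  have hA := isBoundedPullbackAttractor_pullbackFibre hφ hB hne habs
  refine ⟨⟨hA, fun A hA' g hg => (hA'.subset hA.toIsPullbackAttractor hflow hg).antisymm
    (hA.subset hA'.toIsPullbackAttractor hflow hg)⟩, fun hH => ?_⟩
  rw [← omegaLimit_atTop_eq_biInter]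
  refine ⟨isGlobalAttractor_omegaLimit hφ hcont hH hB hne habs, ?_⟩
  rw [pullbackFibre_eq_pullbackLimit, LC.skewProduct_eq_skewMap]
  exact omegaLimit_skewMap hφ hcont hH hB.isCompact_closure (subset_univ _) (habs B hB)

theorem mainTheorem10 (N : ℕ) [MetricSpace (LC N)] (f : LC N)
    (hflow : ∀ t : ℝ, ∀ g ∈ f.hull, LC.translate t g ∈ f.hull)
    (hglobal : ∀ g ∈ f.hull, ∀ x₀ : Phase N, ∃ x : ℝ → Phase N, g.IsSolution x₀ x)
    (hcont : ContinuousOn (fun p : ℝ × (LC N × Phase N) => LC.skewProduct p.1 p.2)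
      (Ici (0 : ℝ) ×ˢ (f.hull ×ˢ (univ : Set (Phase N)))))
    (B : Set (Phase N)) (hB : IsBounded B)
    (habsorb : ∀ D : Set (Phase N), D.Nonempty → IsBounded D →
      ∃ T : ℝ, 0 ≤ T ∧ ∀ s t : ℝ, T ≤ t → LC.sol t (LC.translate s f) '' D ⊆ B) :
    (IsBoundedPullbackAttractor f (pullbackFibre B) ∧
      ∀ A : LC N → Set (Phase N), IsBoundedPullbackAttractor f A →
        ∀ g ∈ f.hull, A g = pullbackFibre B g) ∧
    (IsCompact f.hull →
      IsGlobalAttractor f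
        (⋂ τ ∈ Ici (0 : ℝ), closure (⋃ t ∈ Ici τ, LC.skewProduct t '' (f.hull ×ˢ B))) ∧
      (⋂ τ ∈ Ici (0 : ℝ), closure (⋃ t ∈ Ici τ, LC.skewProduct t '' (f.hull ×ˢ B))) =
        ⋃ g ∈ f.hull, {g} ×ˢ pullbackFibre B g) := by
  exact mainTheorem10_general N f hflow hglobal (fun t ht => hcont.comp (f := fun q => (t, q))
    (by fun_prop) fun _ hq => ⟨ht, hq⟩) B hB habsorb
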